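/- Let $n,m\ge 0$ and let $x_1,\dots,x_n,\ y_1,\dots,y_n,\ z_1,\dots,z_m,\ w_1,\dots,w_m$ be indeterminates. Define $h_r[\boldsymbol x|\boldsymbol y]$ ($r\in\mathbb Z$) by $$\sum_{r\ge 0} h_r[\boldsymbol x|\boldsymbol y]\,t^r=\prod_{i=1}^{n}\frac{1+y_it}{1-x_it},\qquad h_r[\boldsymbol x|\boldsymbol y]=0\ \text{ for } r<0,$$ and, for partitions $\lambda,\mu$ padded by trailing zeros to a common length $\ell$, define the skew supersymmetric Schur function $$s_{\lambda/\mu}[\boldsymbol x|\boldsymbol y]=\det_{1\le i,j\le \ell} h_{\lambda_i-\mu_j-i+j}[\boldsymbol x|\boldsymbol y];$$ $s_{\lambda/\mu}[\boldsymbol z|\boldsymbol w]$ is defined in the same way, with $m$ in place of $n$. **Proposition (Cauchy identity).** For any partitions $\lambda$ and $\mu$, $$\sum_\nu s_{\lambda/\nu}[\boldsymbol x|\boldsymbol y]\,s_{\mu/\nu}[\boldsymbol z|\boldsymbol w]=\prod_{i=1}^{n}\prod_{j=1}^{m}\frac{(1-x_iz_j)(1-y_iw_j)}{(1+x_iw_j)(1+y_iz_j)}\cdot\sum_\nu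 s_{\nu/\mu}[\boldsymbol x|\boldsymbol y]\,s_{\nu/\lambda}[\boldsymbol z|\boldsymbol w]$$ as an identity of formal power series over $\mathbb C$ in all the variables, where both sums run over all partitions $\nu$ (partitions that differ only by trailing zeros being identified). In both sums each monomial occurs in only finitely many terms, so that the sums are well defined. -/

import Mathlib

/-- The supersymmetric complete homogeneous function `h_r[x|y]`, `r ∈ ℤ`, in `x₁, …, x_n` and
`y₁, …, y_n`, i.e. the coefficient of `t ^ r` in `∏ (1 + y_j t) / ∏ (1 - x_i t)`:
`h_r[x|y] = ∑_{a + b = r} h_a(x) e_b(y)` for `r ≥ 0`, and `h_r[x|y] = 0` for `r < 0`. -/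
noncomputable def superH {R : Type*} [CommRing R] {n : ℕ} (x y : Fin n → R) (r : ℤ) : R :=
  if r < 0 then 0
  else ∑ p ∈ Finset.HasAntidiagonal.antidiagonal r.toNat,
    MvPolynomial.aeval x (MvPolynomial.hsymm (Fin n) ℤ p.1) *
      MvPolynomial.aeval y (MvPolynomial.esymm (Fin n) ℤ p.2)

/-- The skew supersymmetric Schur function `s_{α/β}[x|y]`: the Jacobi-Trudi determinant
`det (h_{α_i - β_j - i + j}[x|y])` of size `ℓ`, where the partitions `α` and `β` (the row lengths
of Young diagrams) are padded by trailing zeros to the common length `ℓ = max (ℓ(α), ℓ(β))`. -/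
noncomputable def superSchur {R : Type*} [CommRing R] {n : ℕ} (α β : YoungDiagram)
    (x y : Fin n → R) : R :=
  Matrix.det (Matrix.of fun i j : Fin (max (α.colLen 0) (β.colLen 0)) =>
    superH x y ((α.rowLen i : ℤ) - (β.rowLen j : ℤ) - (i : ℤ) + (j : ℤ)))

/-- A family of formal power series is formally summable if each monomial occurs in only
finitely many members of the family. -/
def FormallySummable {ι σ R : Type*} [CommRing R] (f : ι → MvPowerSeries σ R) : Prop :=
  ∀ d : σ →₀ ℕ, {k : ι | MvPowerSeries.coeff d (f k) ≠ 0}.Finite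

/-- The coefficientwise sum of a (formally summable) family of formal power series. -/
noncomputable def formalSum {ι σ R : Type*} [CommRing R] (f : ι → MvPowerSeries σ R) :
    MvPowerSeries σ R :=
  fun d => ∑ᶠ k, MvPowerSeries.coeff d (f k)

/-- The variables `x₁, …, x_n, y₁, …, y_n, z₁, …, z_m, w₁, …, w_m`. -/
inductive CauchyVar (n m : ℕ) : Type
  | x (i : Fin n) : CauchyVar n m
  | y (i : Fin n) : CauchyVar n m
  | z (j : Fin m) : CauchyVar n m
  | w (j : Fin m) : CauchyVar n m

/-- The ring of formal power series over `ℂ` in the variables `x_i`, `y_i`, `z_j`, `w_j`. -/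
abbrev CauchySeries (n m : ℕ) : Type := MvPowerSeries (CauchyVar n m) ℂ

/-- The family of the variables `x_i` in the power series ring. -/
noncomputable def xVar (n m : ℕ) (i : Fin n) : CauchySeries n m :=
  MvPowerSeries.X (CauchyVar.x i)

/-- The family of the variables `y_i` in the power series ring. -/
noncomputable def yVar (n m : ℕ) (i : Fin n) : CauchySeries n m :=
  MvPowerSeries.X (CauchyVar.y i)

/-- The family of the variables `z_j` in the power series ring. -/
noncomputable def zVar (n m : ℕ) (j : Fin m) : CauchySeries n m :=
  MvPowerSeries.X (CauchyVar.z j)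

/-- The family of the variables `w_j` in the power series ring. -/
noncomputable def wVar (n m : ℕ) (j : Fin m) : CauchySeries n m :=
  MvPowerSeries.X (CauchyVar.w j)

/-! For a power series F with constant term 1, the Jacobi–Trudi determinants of F are minors of its
Toeplitz matrix, with rows and columns indexed by the strictly decreasing sequences λ_i + N - 1 - i.
Toeplitz matrices multiply like their series, so Cauchy–Binet gives s_{α/β}[FG] = ∑ s_{α/ν}[F]
s_{ν/β}[G] (`skew_mul`): F acts on functions of partitions, multiplicatively in F. The Cauchy
identity says that the operator of F commutes with the transposed operator of H up to a scalar
(`Commutes`). Such a relation passes to products in F (`Commutes.mul`) and to inverses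
(`Commutes.of_mul_eq_one`). Since ∏ (1 + y_i t) / (1 - x_i t) is built from linear factors and their
inverses, only F = 1 + yt remains, against a general H (`commutes_linear`).

For this F, Cauchy–Binet turns each side, the upper one truncated to a rectangle, into a single
determinant. Let r_k be the row (h_{b_j - k})_j. The upper side has rows r_{a_i} + y r_{a_i - 1},
the last one being r_0 + y r_{-1}; the lower side differs only in its last row, which is r_0. With E
= 1/H, the relation ∑ e_r r_{r-1} = 0 expresses r_{-1} through r_0, r_1, …, and the rows r_{k+1} + y
r_k coming from zero parts of α allow r_k to be replaced by (-y)^k r_0. The ratio is therefore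
E(-y), up to terms whose order grows with the number of zero parts (`det_shiftedRows_smodEq`).
Limits are taken by congruences modulo the ideals of series of order at least d. -/

namespace SkewCauchy

open Finset

/-! ### The Cauchy–Binet formula. -/

section CauchyBinet

variable {R : Type*} [CommRing R]

/-- Sorting the values of f. With `orderEmb_comp_perm_injective` it factors injective maps uniquely
as a permutation followed by an increasing map, which regroups the sum in Cauchy–Binet. -/
theorem exists_orderEmb_comp_perm {N : ℕ} {κ : Type*} [LinearOrder κ] (f : Fin N → κ)
    (hf : Function.Injective f) :
    ∃ (s : Fin N ↪o κ) (σ : Equiv.Perm (Fin N)), ∀ i, s (σ i) = f i := by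
  classical
  have hcard : (univ.image f).card = N := by
    rw [card_image_of_injective _ hf, card_univ, Fintype.card_fin]
  have hmem : ∀ i, f i ∈ univ.image f := fun i => mem_image_of_mem _ (mem_univ i)
  let e := (univ.image f).orderIsoOfFin hcard
  have hinj : Function.Injective fun i => e.symm ⟨f i, hmem i⟩ := by
    intro i j h
    have := e.symm.injective h
    exact hf (congrArg Subtype.val this)
  refine ⟨(univ.image f).orderEmbOfFin hcard,
    Equiv.ofBijective _ (Finite.injective_iff_bijective.mp hinj), fun i => ?_⟩
  simp [Equiv.ofBijective_apply, ← coe_orderIsoOfFin_apply, e]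

theorem orderEmb_comp_perm_injective {N : ℕ} {κ : Type*} [LinearOrder κ] :
    Function.Injective fun p : (Fin N ↪o κ) × Equiv.Perm (Fin N) => (fun i => p.1 (p.2 i)) := by
  rintro ⟨s, σ⟩ ⟨t, τ⟩ h
  have h' : ∀ i, s (σ i) = t (τ i) := fun i => congrFun h i
  have hr : Set.range s = Set.range t := by
    ext k
    constructor
    · rintro ⟨i, rfl⟩
      exact ⟨τ (σ.symm i), by rw [← h']; simp⟩
    · rintro ⟨i, rfl⟩
      exact ⟨σ (τ.symm i), by rw [h']; simp⟩
  have hst : s = t := OrderEmbedding.range_inj.mp hr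
  subst hst
  have : σ = τ := Equiv.ext fun i => s.injective (h' i)
  rw [this]

/-- The Cauchy–Binet formula. -/
theorem det_mul_transpose {N : ℕ} {κ : Type*} [Fintype κ] [LinearOrder κ]
    (A B : Matrix (Fin N) κ R) :
    (A * B.transpose).det =
      ∑ s : Fin N ↪o κ, (A.submatrix id s).det * (B.submatrix id s).det := by
  classical
  -- Multilinear expansion over all choices of columns; the choices with a repeated column will
  -- contribute zero.
  have h1 : (A * B.transpose).det =
      ∑ f : Fin N → κ, (A.submatrix id f).det * ∏ i, B i (f i) := by
    simp only [Matrix.det_apply', Matrix.mul_apply, prod_univ_sum, mul_sum,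
      Fintype.piFinset_univ]
    rw [sum_comm]
    refine sum_congr rfl fun f _ => ?_
    rw [sum_mul]
    refine sum_congr rfl fun σ _ => ?_
    simp only [prod_mul_distrib, Matrix.submatrix_apply, id, Matrix.transpose_apply, mul_assoc]
  rw [h1]
  have h2 : ∀ s : Fin N ↪o κ, (A.submatrix id s).det * (B.submatrix id s).det =
      ∑ σ : Equiv.Perm (Fin N), (A.submatrix id fun i => s (σ i)).det *
        ∏ i, B i (s (σ i)) := by
    intro s
    rw [← Matrix.det_transpose (B.submatrix id s), Matrix.det_apply' (B.submatrix id s).transpose,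
      mul_sum]
    refine sum_congr rfl fun σ _ => ?_
    have : (A.submatrix id fun i => s (σ i)) = (A.submatrix id s).submatrix id σ := rfl
    rw [this, Matrix.det_permute']
    simp only [Matrix.submatrix_apply, id, Matrix.transpose_apply]
    ring
  simp_rw [h2]
  rw [← Fintype.sum_prod_type']
  symm
  refine Fintype.sum_of_injective _ orderEmb_comp_perm_injective _ _ ?_ (fun _ => rfl)
  intro f hf
  have hni : ¬ Function.Injective f := by
    intro hinj
    obtain ⟨s, σ, h⟩ := exists_orderEmb_comp_perm f hinj
    exact hf ⟨(s, σ), funext h⟩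
  rw [Function.not_injective_iff] at hni
  obtain ⟨i, j, hij, hne⟩ := hni
  rw [Matrix.det_zero_of_column_eq hne (fun k => by simp [hij]), zero_mul]

end CauchyBinet

/-! ### Partitions in a rectangle as strictly decreasing sequences. -/

section Partitions

/-- The rectangle with `N` rows of length `M`. -/
def rect (N M : ℕ) : YoungDiagram where
  cells := range N ×ˢ range M
  isLowerSet := by
    rintro ⟨a, b⟩ ⟨c, d⟩ ⟨h1, h2⟩ h
    simp only [coe_product, coe_range, Set.mem_prod, Set.mem_Iio] at h ⊢
    simp only at h1 h2
    omega

theorem mem_rect {N M : ℕ} {p : ℕ × ℕ} : p ∈ rect N M ↔ p.1 < N ∧ p.2 < M := by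
  rw [← YoungDiagram.mem_cells]
  simp [rect]

theorem finite_le (κ : YoungDiagram) : {ν : YoungDiagram | ν ≤ κ}.Finite := by
  refine Set.Finite.of_finite_image (f := YoungDiagram.cells)
    (κ.cells.powerset.finite_toSet.subset ?_) ?_
  · rintro _ ⟨ν, hν, rfl⟩
    simpa using YoungDiagram.cells_subset_iff.mpr hν
  · intro a _ b _ h
    exact YoungDiagram.ext h

/-- The diagrams contained in `κ`. -/
noncomputable def sub (κ : YoungDiagram) : Finset YoungDiagram := (finite_le κ).toFinset

@[simp]
theorem mem_sub {κ ν : YoungDiagram} : ν ∈ sub κ ↔ ν ≤ κ := by simp [sub]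

theorem le_iff_rowLen_le {μ ν : YoungDiagram} : μ ≤ ν ↔ ∀ i, μ.rowLen i ≤ ν.rowLen i := by
  constructor
  · intro h i
    by_contra! hlt
    exact lt_irrefl _ (YoungDiagram.mem_iff_lt_rowLen.mp
      (h (YoungDiagram.mem_iff_lt_rowLen.mpr hlt)))
  · rintro h ⟨i, j⟩ hp
    exact YoungDiagram.mem_iff_lt_rowLen.mpr
      ((YoungDiagram.mem_iff_lt_rowLen.mp hp).trans_le (h i))

theorem rowLen_pos_iff {ν : YoungDiagram} {i : ℕ} : 0 < ν.rowLen i ↔ i < ν.colLen 0 := by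
  rw [← YoungDiagram.mem_iff_lt_rowLen, ← YoungDiagram.mem_iff_lt_colLen]

theorem rowLen_eq_zero {ν : YoungDiagram} {i : ℕ} (h : ν.colLen 0 ≤ i) : ν.rowLen i = 0 := by
  have := rowLen_pos_iff (ν := ν) (i := i)
  omega

theorem le_rect {ν : YoungDiagram} {N M : ℕ} (h1 : ν.colLen 0 ≤ N) (h2 : ν.rowLen 0 ≤ M) :
    ν ≤ rect N M := by
  rintro ⟨i, j⟩ hp
  rw [mem_rect]
  have h3 := YoungDiagram.mem_iff_lt_rowLen.mp hp
  have h4 := ν.rowLen_anti 0 i (Nat.zero_le i)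
  have h5 := rowLen_pos_iff.mp (Nat.zero_lt_of_lt h3)
  simp only
  omega

theorem colLen_le_of_le {μ ν : YoungDiagram} (h : μ ≤ ν) : μ.colLen 0 ≤ ν.colLen 0 := by
  by_contra! hlt
  have h1 := rowLen_pos_iff.mpr hlt
  have h2 := le_iff_rowLen_le.mp h (ν.colLen 0)
  rw [rowLen_eq_zero (ν := ν) le_rfl] at h2
  omega

theorem colLen_rect_le (N M : ℕ) : (rect N M).colLen 0 ≤ N := by
  by_contra! h
  have := YoungDiagram.mem_iff_lt_colLen.mpr h
  simp [mem_rect] at this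

theorem rowLen_rect_le (N M i : ℕ) : (rect N M).rowLen i ≤ M := by
  by_contra! h
  have := YoungDiagram.mem_iff_lt_rowLen.mpr h
  simp [mem_rect] at this

theorem exists_rowLen_eq (N : ℕ) (f : ℕ → ℕ) (hf : Antitone f) (h0 : f N = 0) :
    ∃ ν : YoungDiagram, ∀ i, ν.rowLen i = f i := by
  let ν : YoungDiagram :=
    { cells := (range N ×ˢ range (f 0)).filter fun p => p.2 < f p.1
      isLowerSet := by
        rintro ⟨a, b⟩ ⟨c, d⟩ ⟨h1, h2⟩ h
        simp only [coe_filter, mem_product, mem_range, Set.mem_ofPred_eq] at h ⊢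
        simp only at h1 h2
        have := hf h1
        omega }
  have hν : ∀ i j, (i, j) ∈ ν ↔ j < f i := by
    intro i j
    rw [← YoungDiagram.mem_cells]
    simp only [ν, mem_filter, mem_product, mem_range, and_iff_right_iff_imp]
    intro h
    have h1 := hf (Nat.zero_le i)
    refine ⟨?_, by omega⟩
    by_contra! h2
    have := hf h2
    omega
  refine ⟨ν, fun i => ?_⟩
  refine le_antisymm ?_ ?_
  · by_contra! h
    exact lt_irrefl _ ((hν _ _).mp (YoungDiagram.mem_iff_lt_rowLen.mpr h))
  · by_contra! h
    exact lt_irrefl _ (YoungDiagram.mem_iff_lt_rowLen.mp ((hν _ _).mpr h))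

/-- The strictly decreasing sequence `ν_i + N - 1 - i` attached to a partition with at most
`N` parts. -/
def beta (N : ℕ) (ν : YoungDiagram) (i : Fin N) : ℕ := ν.rowLen i + (N - 1 - i)

theorem beta_strictAnti (N : ℕ) (ν : YoungDiagram) : StrictAnti (beta N ν) := by
  intro i j h
  have h1 := ν.rowLen_anti i j (le_of_lt h)
  have h2 : (i : ℕ) < j := h
  have := j.isLt
  simp only [beta]
  omega

theorem beta_lt {N M : ℕ} {ν : YoungDiagram} (h : ν ≤ rect N M) (i : Fin N) :
    beta N ν i < N + M := by
  have h1 := (le_iff_rowLen_le.mp h i).trans (rowLen_rect_le N M i)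
  have := i.isLt
  simp only [beta]
  omega

theorem beta_injOn {N M : ℕ} {μ ν : YoungDiagram} (hμ : μ ≤ rect N M) (hν : ν ≤ rect N M)
    (h : beta N μ = beta N ν) : μ = ν := by
  have key : ∀ i, μ.rowLen i = ν.rowLen i := by
    intro i
    by_cases hi : i < N
    · have := congrFun h ⟨i, hi⟩
      simpa [beta] using this
    · have h1 := (colLen_le_of_le hμ).trans (colLen_rect_le N M)
      have h2 := (colLen_le_of_le hν).trans (colLen_rect_le N M)
      rw [rowLen_eq_zero (by omega), rowLen_eq_zero (by omega)]
  exact le_antisymm (le_iff_rowLen_le.mpr fun i => (key i).le)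
    (le_iff_rowLen_le.mpr fun i => (key i).ge)

theorem add_le_of_strictAnti {N : ℕ} {s : Fin N → ℕ} (hs : StrictAnti s) {i j : ℕ} (hij : i ≤ j)
    (hj : j < N) : s ⟨j, hj⟩ + j ≤ s ⟨i, hij.trans_lt hj⟩ + i := by
  induction j, hij using Nat.le_induction with
  | base => rfl
  | succ k hk ih =>
    have h1 := ih (by omega)
    have h2 : s ⟨k + 1, hj⟩ < s ⟨k, by omega⟩ := hs (by simp [Fin.lt_def])
    omega

theorem exists_beta_eq {N M : ℕ} {s : Fin N → ℕ} (hs : StrictAnti s) (hM : ∀ i, s i < N + M) :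
    ∃ ν ≤ rect N M, beta N ν = s := by
  let f : ℕ → ℕ := fun i => if h : i < N then s ⟨i, h⟩ + i - (N - 1) else 0
  have hf : Antitone f := by
    intro i j hij
    simp only [f]
    split_ifs with h1 h2
    · have := add_le_of_strictAnti hs hij h1
      omega
    · omega
    · omega
    · exact le_rfl
  obtain ⟨ν, hν⟩ := exists_rowLen_eq N f hf (by simp [f])
  refine ⟨ν, le_rect ?_ ?_, funext fun i => ?_⟩
  · by_contra! h
    have := rowLen_pos_iff.mpr h
    rw [hν] at this
    simp [f] at this
  · rw [hν]
    simp only [f]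
    split_ifs with h
    · have := hM ⟨0, h⟩
      omega
    · omega
  · have := i.isLt
    -- Comparison with the last index gives s_i + i ≥ N - 1, so the truncated subtraction in f is
    -- exact.
    have h1 := add_le_of_strictAnti hs (i := i) (j := N - 1) (by omega) (by omega)
    simp only [beta, hν, f, i.isLt, dif_pos]
    simp only [Fin.eta] at h1 ⊢
    omega

/-- The strictly decreasing sequence `beta N ν` as an order embedding. -/
def betaEmb {N M : ℕ} {ν : YoungDiagram} (h : ν ≤ rect N M) : Fin N ↪o (Fin (N + M))ᵒᵈ :=
  OrderEmbedding.ofStrictMono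
    (fun i => OrderDual.toDual (⟨beta N ν i, beta_lt h i⟩ : Fin (N + M)))
    (fun _ _ hij => beta_strictAnti N ν hij)

/-- Cauchy–Binet with the N-subsets of the N + M columns encoded by partitions in the N × M
rectangle. Columns carry the dual order because `beta` is decreasing. -/
theorem sum_det_mul_det {R : Type*} [CommRing R] (N M : ℕ) (A B : Fin N → ℕ → R) :
    ∑ ν ∈ sub (rect N M), (Matrix.of fun i j => A i (beta N ν j)).det *
        (Matrix.of fun i j => B i (beta N ν j)).det =
      (Matrix.of fun i j : Fin N => ∑ k ∈ range (N + M), A i k * B j k).det := by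
  classical
  have hmul : (Matrix.of fun i j : Fin N => ∑ k ∈ range (N + M), A i k * B j k) =
      (Matrix.of fun (i : Fin N) (k : (Fin (N + M))ᵒᵈ) => A i (OrderDual.ofDual k : Fin (N + M))) *
      (Matrix.of fun (i : Fin N) (k : (Fin (N + M))ᵒᵈ) =>
        B i (OrderDual.ofDual k : Fin (N + M))).transpose := by
    ext i j
    simp only [Matrix.of_apply, Matrix.mul_apply, Matrix.transpose_apply]
    rw [← Fin.sum_univ_eq_sum_range (fun k => A i k * B j k)]
    exact Fintype.sum_equiv OrderDual.toDual _ _ (fun k => by simp)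
  rw [hmul, det_mul_transpose]
  refine sum_bij (fun ν hν => betaEmb (mem_sub.mp hν)) (fun _ _ => mem_univ _) ?_ ?_ ?_
  · intro μ hμ ν hν h
    refine beta_injOn (mem_sub.mp hμ) (mem_sub.mp hν) (funext fun i => ?_)
    exact congrArg (fun e : Fin N ↪o (Fin (N + M))ᵒᵈ => ((OrderDual.ofDual (e i) : Fin _) : ℕ)) h
  · intro e _
    obtain ⟨ν, hν, h⟩ := exists_beta_eq (N := N) (M := M)
      (s := fun i => ((OrderDual.ofDual (e i) : Fin _) : ℕ))
      (fun i j hij => e.strictMono hij) (fun i => (OrderDual.ofDual (e i)).isLt)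
    refine ⟨ν, mem_sub.mpr hν, DFunLike.ext _ _ fun i => ?_⟩
    exact congrArg OrderDual.toDual (Fin.ext (congrFun h i))
  · intro ν hν
    rfl

end Partitions

/-! ### Toeplitz minors and skew Schur functions of a power series. -/

section Minors

variable {R : Type*} [CommRing R]

/-- The coefficients of a power series, extended by zero to negative indices. -/
noncomputable def icoeff (F : PowerSeries R) (r : ℤ) : R :=
  if r < 0 then 0 else PowerSeries.coeff r.toNat F

theorem icoeff_neg {F : PowerSeries R} {r : ℤ} (h : r < 0) : icoeff F r = 0 := if_pos h

@[simp]
theorem icoeff_natCast (F : PowerSeries R) (n : ℕ) :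
    icoeff F n = PowerSeries.coeff n F := by
  simp [icoeff]

theorem icoeff_one (r : ℤ) : icoeff (1 : PowerSeries R) r = if r = 0 then 1 else 0 := by
  rcases lt_or_ge r 0 with h | h
  · rw [icoeff_neg h, if_neg h.ne]
  · lift r to ℕ using h
    rw [icoeff_natCast, PowerSeries.coeff_one]
    simp

/-- Toeplitz matrices multiply like their series. Only b ≤ k ≤ a contributes, so a finite range
reaching past a loses nothing. -/
theorem sum_icoeff_mul (F G : PowerSeries R) {a b K : ℕ} (h : a < K) :
    ∑ k ∈ range K, icoeff F (a - k) * icoeff G (k - b) = icoeff (F * G) (a - b) := by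
  rcases lt_or_ge a b with hab | hab
  · rw [icoeff_neg (by omega)]
    refine sum_eq_zero fun k _ => ?_
    rcases lt_or_ge a k with hk | hk
    · rw [icoeff_neg (by omega), zero_mul]
    · rw [icoeff_neg (r := (k : ℤ) - b) (by omega), mul_zero]
  · obtain ⟨n, rfl⟩ := Nat.exists_eq_add_of_le hab
    have h1 : ((b + n : ℕ) : ℤ) - b = (n : ℕ) := by push_cast; ring
    rw [h1, icoeff_natCast, PowerSeries.coeff_mul]
    symm
    refine sum_of_injOn (fun p => b + p.2) ?_ ?_ ?_ ?_
    · rintro ⟨p, q⟩ h1 ⟨p', q'⟩ h2 h3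
      simp only [mem_coe, HasAntidiagonal.mem_antidiagonal] at h1 h2 h3
      ext <;> simp only <;> omega
    · rintro ⟨p, q⟩ h1
      simp only [mem_coe, HasAntidiagonal.mem_antidiagonal, mem_range] at h1 ⊢
      omega
    · intro k _ hk
      by_cases h1 : b ≤ k ∧ k ≤ b + n
      · exfalso
        refine hk ⟨(b + n - k, k - b), ?_, ?_⟩
        · simp only [mem_coe, HasAntidiagonal.mem_antidiagonal]
          omega
        · simp only
          omega
      · rcases lt_or_ge k b with h2 | h2
        · rw [icoeff_neg (r := (k : ℤ) - b) (by omega), mul_zero]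
        · rw [icoeff_neg (by omega), zero_mul]
    · rintro ⟨p, q⟩ h1
      rw [HasAntidiagonal.mem_antidiagonal] at h1
      simp only at h1 ⊢
      have e1 : ((b + n : ℕ) : ℤ) - (b + q : ℕ) = (p : ℕ) := by push_cast; omega
      have e2 : ((b + q : ℕ) : ℤ) - b = (q : ℕ) := by push_cast; ring
      rw [e1, e2, icoeff_natCast, icoeff_natCast]

/-- The Jacobi–Trudi determinant of size `N` of a power series. -/
noncomputable def minor (F : PowerSeries R) (N : ℕ) (α β : YoungDiagram) : R :=
  (Matrix.of fun i j : Fin N => icoeff F ((beta N α i : ℤ) - beta N β j)).det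

theorem beta_sub_beta {N : ℕ} (α β : YoungDiagram) (i j : Fin N) :
    (beta N α i : ℤ) - beta N β j = (α.rowLen i : ℤ) - β.rowLen j - i + j := by
  have := i.isLt
  have := j.isLt
  simp only [beta]
  omega

/-- An additional zero part adds a last row whose indices are negative off the diagonal and whose
corner is h_0 = 1. -/
theorem minor_succ {F : PowerSeries R} (hF : PowerSeries.coeff 0 F = 1) {N : ℕ}
    {α β : YoungDiagram} (hα : α.colLen 0 ≤ N) (hβ : β.colLen 0 ≤ N) :
    minor F (N + 1) α β = minor F N α β := by
  simp only [minor, beta_sub_beta]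
  rw [Matrix.det_succ_row _ (Fin.last N), Fin.sum_univ_castSucc]
  rw [sum_eq_zero, zero_add]
  · simp only [Matrix.of_apply, Fin.val_last, rowLen_eq_zero hα, rowLen_eq_zero hβ]
    have : icoeff F ((0 : ℕ) - (0 : ℕ) - (N : ℤ) + N) = 1 := by
      have h : ((0 : ℕ) - (0 : ℕ) - (N : ℤ) + N) = (0 : ℕ) := by simp
      rw [h, icoeff_natCast, hF]
    rw [this, ← two_mul, pow_mul]
    simp only [even_two, Even.neg_pow, one_pow, one_mul]
    congr 1
    ext i j
    simp
  · intro j _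
    simp only [Matrix.of_apply, Fin.val_last, rowLen_eq_zero hα, Fin.val_castSucc]
    have := j.isLt
    rw [icoeff_neg (by omega)]
    simp

theorem minor_eq_of_le {F : PowerSeries R} (hF : PowerSeries.coeff 0 F = 1) {N K : ℕ}
    {α β : YoungDiagram} (hα : α.colLen 0 ≤ N) (hβ : β.colLen 0 ≤ N) (h : N ≤ K) :
    minor F K α β = minor F N α β := by
  induction K, h using Nat.le_induction with
  | base => rfl
  | succ k hk ih => rw [minor_succ hF (hα.trans hk) (hβ.trans hk), ih]

/-- The skew Schur function of a power series: the Jacobi–Trudi determinant whose size is the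
larger of the numbers of parts. -/
noncomputable def skew (F : PowerSeries R) (α β : YoungDiagram) : R :=
  minor F (max (α.colLen 0) (β.colLen 0)) α β

theorem minor_eq_skew {F : PowerSeries R} (hF : PowerSeries.coeff 0 F = 1) {N : ℕ}
    {α β : YoungDiagram} (hα : α.colLen 0 ≤ N) (hβ : β.colLen 0 ≤ N) :
    minor F N α β = skew F α β :=
  minor_eq_of_le hF (le_max_left _ _) (le_max_right _ _) (max_le hα hβ)

theorem exists_perm_apply_le {N : ℕ} (p : Fin N) (σ : Equiv.Perm (Fin N)) :
    ∃ j ≤ p, p ≤ σ j := by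
  by_contra! h
  have h1 : (Finset.Iic p).card ≤ (Finset.Iio p).card :=
    card_le_card_of_injOn σ (fun j hj => by
      have := h j (by simpa using hj)
      simpa using this) σ.injective.injOn
  simp at h1

/-- If β_p > α_p, every permutation sends some j ≤ p to σ j ≥ p, and the entry there has index at
most α_p - β_p < 0. Hence each Leibniz term vanishes. -/
theorem minor_eq_zero {F : PowerSeries R} {N : ℕ} {α β : YoungDiagram}
    (hβ : β.colLen 0 ≤ N) (h : ¬ β ≤ α) : minor F N α β = 0 := by
  rw [le_iff_rowLen_le] at h
  push Not at h
  obtain ⟨p, hp⟩ := h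
  have hpN : p < N := by
    by_contra! hle
    rw [rowLen_eq_zero (hβ.trans hle)] at hp
    omega
  rw [minor, Matrix.det_apply']
  refine sum_eq_zero fun σ _ => ?_
  obtain ⟨j, hj, hσ⟩ := exists_perm_apply_le ⟨p, hpN⟩ σ
  rw [prod_eq_zero (mem_univ j), mul_zero]
  rw [Matrix.of_apply, beta_sub_beta]
  have h1 := α.rowLen_anti p (σ j) hσ
  have h2 := β.rowLen_anti j p hj
  have h3 : (j : ℕ) ≤ p := hj
  have h4 : p ≤ (σ j : ℕ) := hσ
  exact icoeff_neg (by omega)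

theorem skew_eq_zero {F : PowerSeries R} {α β : YoungDiagram} (h : ¬ β ≤ α) :
    skew F α β = 0 := minor_eq_zero (le_max_right _ _) h

theorem minor_one_comm (N : ℕ) (α β : YoungDiagram) :
    minor (1 : PowerSeries R) N α β = minor 1 N β α := by
  rw [minor, ← Matrix.det_transpose, minor]
  congr 1
  ext i j
  simp only [Matrix.transpose_apply, Matrix.of_apply, icoeff_one, sub_eq_zero, Nat.cast_inj]
  simp only [eq_comm]

theorem skew_one_self (α : YoungDiagram) : skew (1 : PowerSeries R) α α = 1 := by
  rw [skew, minor]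
  refine Eq.trans (congrArg Matrix.det (Matrix.ext fun i j => ?_)) Matrix.det_one
  simp only [Matrix.of_apply, icoeff_one, Matrix.one_apply, sub_eq_zero, Nat.cast_inj,
    (beta_strictAnti _ α).injective.eq_iff]

theorem skew_one_of_ne {α β : YoungDiagram} (h : α ≠ β) :
    skew (1 : PowerSeries R) α β = 0 := by
  by_cases h1 : β ≤ α
  · rw [skew, minor_one_comm]
    exact minor_eq_zero (le_max_left _ _) fun h2 => h (le_antisymm h2 h1)
  · exact skew_eq_zero h1

/-- Cauchy–Binet for the factorization of the Toeplitz matrix of F * G. Only α has to fit in the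
rectangle, since the intermediate column indices do not exceed those of α. -/
theorem minor_mul (F G : PowerSeries R) {N M : ℕ} {α β : YoungDiagram} (hα : α ≤ rect N M) :
    minor (F * G) N α β = ∑ ν ∈ sub (rect N M), minor F N α ν * minor G N ν β := by
  have h := sum_det_mul_det N M (fun i k => icoeff F ((beta N α i : ℤ) - k))
    (fun j k => icoeff G ((k : ℤ) - beta N β j))
  simp only [sum_icoeff_mul F G (beta_lt hα _)] at h
  rw [minor, ← h]
  refine sum_congr rfl fun ν _ => ?_
  congr 1
  rw [← Matrix.det_transpose]
  rfl

theorem skew_mul {F G : PowerSeries R} (hF : PowerSeries.coeff 0 F = 1)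
    (hG : PowerSeries.coeff 0 G = 1) (α β : YoungDiagram) {P : Finset YoungDiagram}
    (hP : sub α ⊆ P) : skew (F * G) α β = ∑ ν ∈ P, skew F α ν * skew G ν β := by
  have h0 : ∀ P : Finset YoungDiagram, sub α ⊆ P →
      ∑ ν ∈ sub α, skew F α ν * skew G ν β = ∑ ν ∈ P, skew F α ν * skew G ν β := by
    intro P hP
    refine sum_subset hP fun ν _ h => ?_
    rw [skew_eq_zero (by simpa using h), zero_mul]
  rw [← h0 P hP]
  set N := max (α.colLen 0) (β.colLen 0)
  have hα : α ≤ rect N (α.rowLen 0) := le_rect (le_max_left _ _) le_rfl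
  rw [skew, minor_mul F G hα, h0 (sub (rect N (α.rowLen 0)))]
  · refine sum_congr rfl fun ν hν => ?_
    have h1 := (colLen_le_of_le (mem_sub.mp hν)).trans (colLen_rect_le _ _)
    rw [minor_eq_skew hF (le_max_left _ _) h1, minor_eq_skew hG h1 (le_max_right _ _)]
  · intro ν hν
    exact mem_sub.mpr ((mem_sub.mp hν).trans hα)

end Minors

/-! ### The order filtration and the algebra of commutation relations. -/

section Filtration

variable {σ R : Type*} [CommRing R]

/-- The ideal of the power series of order at least `d`. -/
noncomputable def orderIdeal (σ R : Type*) [CommRing R] (d : ℕ) : Ideal (MvPowerSeries σ R) where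
  carrier := {f | (d : ℕ∞) ≤ f.order}
  add_mem' ha hb := (le_min ha hb).trans MvPowerSeries.min_order_le_add
  zero_mem' := by simp
  smul_mem' c f hf := le_trans (le_trans hf le_add_self) MvPowerSeries.le_order_mul

theorem mem_orderIdeal {d : ℕ} {f : MvPowerSeries σ R} :
    f ∈ orderIdeal σ R d ↔ (d : ℕ∞) ≤ f.order := Iff.rfl

theorem mem_orderIdeal_iff_coeff {d : ℕ} {f : MvPowerSeries σ R} :
    f ∈ orderIdeal σ R d ↔ ∀ m, m.degree < d → MvPowerSeries.coeff m f = 0 := by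
  rw [mem_orderIdeal]
  constructor
  · intro h m hm
    exact MvPowerSeries.coeff_of_lt_order (lt_of_lt_of_le (by exact_mod_cast hm) h)
  · exact MvPowerSeries.nat_le_order

theorem orderIdeal_anti {d e : ℕ} (h : d ≤ e) : orderIdeal σ R e ≤ orderIdeal σ R d :=
  fun _ hf => le_trans (Nat.cast_le (α := ℕ∞).mpr h) hf

theorem mem_orderIdeal_zero (f : MvPowerSeries σ R) : f ∈ orderIdeal σ R 0 := by
  rw [mem_orderIdeal]
  simp

theorem mul_mem_orderIdeal {d e : ℕ} {f g : MvPowerSeries σ R} (hf : f ∈ orderIdeal σ R d)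
    (hg : g ∈ orderIdeal σ R e) : f * g ∈ orderIdeal σ R (d + e) := by
  rw [mem_orderIdeal] at *
  refine le_trans ?_ MvPowerSeries.le_order_mul
  push_cast
  exact add_le_add hf hg

theorem prod_mem_orderIdeal {ι : Type*} (s : Finset ι) {f : ι → MvPowerSeries σ R} {d : ι → ℕ}
    (h : ∀ i ∈ s, f i ∈ orderIdeal σ R (d i)) :
    ∏ i ∈ s, f i ∈ orderIdeal σ R (∑ i ∈ s, d i) := by
  rw [mem_orderIdeal]
  refine le_trans ?_ (MvPowerSeries.le_order_prod _ _)
  push_cast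
  exact sum_le_sum h

theorem eq_of_smodEq {f g : MvPowerSeries σ R}
    (h : ∀ d, f ≡ g [SMOD orderIdeal σ R d]) : f = g := by
  ext m
  have h1 := mem_orderIdeal_iff_coeff.mp (SModEq.sub_mem.mp (h (m.degree + 1))) m
    (Nat.lt_succ_self _)
  rwa [map_sub, sub_eq_zero] at h1

theorem formalSum_smodEq {ι : Type*} {f : ι → MvPowerSeries σ R} {s : Finset ι} {d : ℕ}
    (h : ∀ k ∉ s, f k ∈ orderIdeal σ R d) :
    formalSum f ≡ ∑ k ∈ s, f k [SMOD orderIdeal σ R d] := by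
  rw [SModEq.sub_mem, mem_orderIdeal_iff_coeff]
  intro m hm
  rw [map_sub, map_sum, sub_eq_zero]
  change ∑ᶠ k, MvPowerSeries.coeff m (f k) = _
  refine finsum_eq_sum_of_support_subset _ fun k hk => ?_
  by_contra hks
  exact hk (mem_orderIdeal_iff_coeff.mp (h k hks) m hm)

/-- A power series whose `r`-th coefficient has order at least `r`. -/
def Graded (F : PowerSeries (MvPowerSeries σ R)) : Prop :=
  ∀ r, PowerSeries.coeff r F ∈ orderIdeal σ R r

theorem Graded.icoeff_mem {F : PowerSeries (MvPowerSeries σ R)} (hF : Graded F) (r : ℤ) :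
    icoeff F r ∈ orderIdeal σ R r.toNat := by
  rw [icoeff]
  split_ifs
  · exact zero_mem _
  · exact hF _

theorem Graded.mul {F G : PowerSeries (MvPowerSeries σ R)} (hF : Graded F) (hG : Graded G) :
    Graded (F * G) := by
  intro r
  rw [PowerSeries.coeff_mul]
  refine sum_mem fun p hp => ?_
  rw [← HasAntidiagonal.mem_antidiagonal.mp hp]
  exact mul_mem_orderIdeal (hF _) (hG _)

theorem Graded.one : Graded (1 : PowerSeries (MvPowerSeries σ R)) := by
  intro r
  rw [PowerSeries.coeff_one]
  split_ifs with h
  · rw [h]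
    exact mem_orderIdeal_zero _
  · exact zero_mem _

theorem Graded.prod {ι : Type*} (s : Finset ι) {F : ι → PowerSeries (MvPowerSeries σ R)}
    (h : ∀ i, Graded (F i)) : Graded (∏ i ∈ s, F i) :=
  prod_induction _ _ (fun _ _ => Graded.mul) Graded.one fun i _ => h i

/-- The number of cells of a Young diagram, as a sum of row lengths. -/
def weight (ν : YoungDiagram) : ℕ := ∑ i ∈ range (ν.colLen 0), ν.rowLen i

theorem sum_rowLen {ν : YoungDiagram} {N : ℕ} (h : ν.colLen 0 ≤ N) :
    ∑ i ∈ range N, ν.rowLen i = weight ν := by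
  symm
  refine sum_subset (fun i hi => ?_) fun i _ hi => ?_
  · rw [mem_range] at *
    omega
  · rw [mem_range] at hi
    exact rowLen_eq_zero (by omega)

theorem weight_mono {μ ν : YoungDiagram} (h : μ ≤ ν) : weight μ ≤ weight ν := by
  rw [← sum_rowLen (colLen_le_of_le h), ← sum_rowLen (le_refl (ν.colLen 0))]
  exact sum_le_sum fun i _ => le_iff_rowLen_le.mp h i

theorem le_weight_of_not_le_rect {ν : YoungDiagram} {n : ℕ} (h : ¬ ν ≤ rect n n) :
    n ≤ weight ν := by
  have h1 : ν.rowLen 0 ≤ weight ν := by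
    rcases Nat.eq_zero_or_pos (ν.rowLen 0) with h0 | h0
    · omega
    · exact single_le_sum (f := fun i => ν.rowLen i) (fun _ _ => Nat.zero_le _)
        (mem_range.mpr (rowLen_pos_iff.mp h0))
  have h2 : ν.colLen 0 ≤ weight ν := by
    calc ν.colLen 0 = ∑ i ∈ range (ν.colLen 0), 1 := by simp
      _ ≤ weight ν := sum_le_sum fun i hi => rowLen_pos_iff.mpr (mem_range.mp hi)
  by_contra! h3
  exact h (le_rect (by omega) (by omega))

/-- In each Leibniz term the indices add up to |α| - |β|, the staircase shifts cancelling;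
truncating negative indices to zero can only raise this sum. -/
theorem minor_mem_orderIdeal {F : PowerSeries (MvPowerSeries σ R)} (hF : Graded F) {N : ℕ}
    {α β : YoungDiagram} (hα : α.colLen 0 ≤ N) (hβ : β.colLen 0 ≤ N) :
    minor F N α β ∈ orderIdeal σ R (weight α - weight β) := by
  rw [minor, Matrix.det_apply']
  refine sum_mem fun π _ => Ideal.mul_mem_left _ _ ?_
  refine orderIdeal_anti ?_ (prod_mem_orderIdeal univ fun i _ => hF.icoeff_mem _)
  have h1 : ∀ ν : YoungDiagram, ν.colLen 0 ≤ N →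
      ∑ i : Fin N, (beta N ν i : ℤ) = weight ν + ∑ i : Fin N, ((N - 1 - i : ℕ) : ℤ) := by
    intro ν hν
    rw [← sum_rowLen hν, ← Fin.sum_univ_eq_sum_range (fun i => ν.rowLen i)]
    push_cast [beta]
    rw [sum_add_distrib]
  have h2 : ∑ i, ((beta N α (π i) : ℤ) - beta N β i) = weight α - weight β := by
    rw [sum_sub_distrib, Equiv.sum_comp π fun i => (beta N α i : ℤ), h1 α hα, h1 β hβ]
    ring
  have h3 : ∑ i, ((beta N α (π i) : ℤ) - beta N β i) ≤
      ((∑ i, ((beta N α (π i) : ℤ) - beta N β i).toNat : ℕ) : ℤ) := by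
    push_cast
    exact sum_le_sum fun i _ => Int.self_le_toNat _
  rw [h2] at h3
  omega

theorem skew_mem_orderIdeal {F : PowerSeries (MvPowerSeries σ R)} (hF : Graded F)
    {α ν : YoungDiagram} {n d : ℕ} (hn : d + weight α ≤ n) (h : ¬ ν ≤ rect n n) :
    skew F ν α ∈ orderIdeal σ R d := by
  refine orderIdeal_anti ?_ (minor_mem_orderIdeal hF (le_max_left _ _) (le_max_right _ _))
  have := le_weight_of_not_le_rect h
  omega

/-- The side of the Cauchy identity that sums over the diagrams contained in `α`. -/
noncomputable def lowerSum (F H : PowerSeries (MvPowerSeries σ R)) (α β : YoungDiagram) :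
    MvPowerSeries σ R := ∑ ν ∈ sub α, skew F α ν * skew H β ν

/-- The side of the Cauchy identity that sums over the diagrams containing `α` and `β`. -/
noncomputable def upperSum (F H : PowerSeries (MvPowerSeries σ R)) (α β : YoungDiagram) :
    MvPowerSeries σ R := formalSum fun ν => skew F ν β * skew H ν α

theorem upperSum_smodEq (F : PowerSeries (MvPowerSeries σ R))
    {H : PowerSeries (MvPowerSeries σ R)} (hH : Graded H) {α : YoungDiagram} (β : YoungDiagram)
    {n d : ℕ} (hn : d + weight α ≤ n) :
    upperSum F H α β ≡ ∑ ν ∈ sub (rect n n), skew F ν β * skew H ν α [SMOD orderIdeal σ R d] :=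
  formalSum_smodEq fun ν hν =>
    Ideal.mul_mem_left _ _ (skew_mem_orderIdeal hH hn (by simpa using hν))

/-- The skew Cauchy identity for the power series `F` and `H` with kernel `c`. -/
def Commutes (F H : PowerSeries (MvPowerSeries σ R)) (c : MvPowerSeries σ R) : Prop :=
  ∀ α β, upperSum F H α β = c * lowerSum F H α β

/-- Split s_{ν/β}[FG] through an intermediate ρ, then move F past H by hypothesis. Modulo order d
all sums are finite and can be exchanged. No commutation of G is assumed, which lets the lemma serve
both products and inverses. -/
theorem Commutes.upperSum_mul {F G H : PowerSeries (MvPowerSeries σ R)} {c : MvPowerSeries σ R}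
    (h : Commutes F H c) (hH : Graded H) (hF : PowerSeries.coeff 0 F = 1)
    (hG : PowerSeries.coeff 0 G = 1) (α β : YoungDiagram) :
    upperSum (F * G) H α β = c * ∑ τ ∈ sub α, skew F α τ * upperSum G H τ β := by
  refine eq_of_smodEq fun d => ?_
  set n := d + weight α
  set P := sub (rect n n)
  have h1 : ∑ ν ∈ P, skew (F * G) ν β * skew H ν α =
      ∑ ρ ∈ P, skew G ρ β * ∑ ν ∈ P, skew F ν ρ * skew H ν α := by
    simp only [mul_sum]
    rw [sum_comm]
    refine sum_congr rfl fun ν hν => ?_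
    rw [skew_mul hF hG ν β (P := P), sum_mul]
    · exact sum_congr rfl fun ρ _ => by ring
    · intro ρ hρ
      exact mem_sub.mpr ((mem_sub.mp hρ).trans (mem_sub.mp hν))
  have h2 : ∑ ρ ∈ P, skew G ρ β * (c * lowerSum F H α ρ) =
      c * ∑ τ ∈ sub α, skew F α τ * ∑ ρ ∈ P, skew G ρ β * skew H ρ τ := by
    simp only [lowerSum, mul_sum]
    rw [sum_comm]
    exact sum_congr rfl fun τ _ => sum_congr rfl fun ρ _ => by ring
  refine (upperSum_smodEq _ hH β le_rfl).trans ?_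
  rw [h1]
  refine SModEq.trans (y := ∑ ρ ∈ P, skew G ρ β * (c * lowerSum F H α ρ)) ?_ ?_
  · refine SModEq.sum fun ρ _ => SModEq.rfl.mul ?_
    rw [← h α ρ]
    exact (upperSum_smodEq _ hH ρ le_rfl).symm
  · rw [h2]
    refine SModEq.rfl.mul (SModEq.sum fun τ hτ => SModEq.rfl.mul ?_)
    -- The truncation chosen for α also serves every τ ⊆ α, as τ has no more cells.
    exact (upperSum_smodEq _ hH β
      (Nat.add_le_add_left (weight_mono (mem_sub.mp hτ)) d)).symm

theorem sum_skew_mul_sum {F G : PowerSeries (MvPowerSeries σ R)} (hF : PowerSeries.coeff 0 F = 1)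
    (hG : PowerSeries.coeff 0 G = 1) (f : YoungDiagram → MvPowerSeries σ R) (α : YoungDiagram) :
    ∑ τ ∈ sub α, skew F α τ * ∑ ν ∈ sub τ, skew G τ ν * f ν =
      ∑ ν ∈ sub α, skew (F * G) α ν * f ν := by
  have h1 : ∀ τ ∈ sub α, ∑ ν ∈ sub τ, skew G τ ν * f ν = ∑ ν ∈ sub α, skew G τ ν * f ν := by
    intro τ hτ
    refine sum_subset (fun ν hν => ?_) fun ν _ hν => ?_
    · exact mem_sub.mpr ((mem_sub.mp hν).trans (mem_sub.mp hτ))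
    · rw [skew_eq_zero (by simpa using hν), zero_mul]
  rw [sum_congr rfl fun τ hτ => by rw [h1 τ hτ]]
  simp only [mul_sum]
  rw [sum_comm]
  refine sum_congr rfl fun ν _ => ?_
  rw [skew_mul hF hG α ν subset_rfl, sum_mul]
  exact sum_congr rfl fun τ _ => by ring

theorem Commutes.mul {F G H : PowerSeries (MvPowerSeries σ R)} {c d : MvPowerSeries σ R}
    (hF : Commutes F H c) (hG : Commutes G H d) (hH : Graded H)
    (hF0 : PowerSeries.coeff 0 F = 1) (hG0 : PowerSeries.coeff 0 G = 1) :
    Commutes (F * G) H (c * d) := by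
  intro α β
  rw [hF.upperSum_mul hH hF0 hG0, lowerSum, ← sum_skew_mul_sum hF0 hG0, mul_assoc]
  congr 1
  rw [mul_sum]
  refine sum_congr rfl fun τ _ => ?_
  rw [hG τ β, lowerSum]
  ring

theorem sum_skew_one (f : YoungDiagram → MvPowerSeries σ R) (α : YoungDiagram) :
    ∑ ν ∈ sub α, skew (1 : PowerSeries (MvPowerSeries σ R)) α ν * f ν = f α := by
  rw [sum_eq_single α]
  · rw [skew_one_self, one_mul]
  · intro ν _ h
    rw [skew_one_of_ne h.symm, zero_mul]
  · intro h
    simp at h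

theorem upperSum_one (H : PowerSeries (MvPowerSeries σ R)) (α β : YoungDiagram) :
    upperSum 1 H α β = skew H β α := by
  ext m
  change ∑ᶠ ν, MvPowerSeries.coeff m (skew 1 ν β * skew H ν α) = _
  rw [finsum_eq_single _ β fun ν h => by rw [skew_one_of_ne h, zero_mul, map_zero],
    skew_one_self, one_mul]

/-- Moving F past H in the trivial case F * G = 1 writes s_{β/τ}[H] as c times the operator of F
applied to the upper sums of G; the operator of G then undoes that of F. -/
theorem Commutes.of_mul_eq_one {F G H : PowerSeries (MvPowerSeries σ R)}
    {c d : MvPowerSeries σ R} (hF : Commutes F H c) (hH : Graded H)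
    (hF0 : PowerSeries.coeff 0 F = 1) (hG0 : PowerSeries.coeff 0 G = 1)
    (hFG : F * G = 1) (hcd : c * d = 1) : Commutes G H d := by
  intro α β
  have h1 : ∀ τ, skew H β τ = c * ∑ ρ ∈ sub τ, skew F τ ρ * upperSum G H ρ β := by
    intro τ
    rw [← hF.upperSum_mul hH hF0 hG0, hFG, upperSum_one]
  rw [lowerSum, sum_congr rfl fun τ _ => by rw [h1 τ, mul_left_comm], ← mul_sum,
    sum_skew_mul_sum hG0 hF0, mul_comm G F, hFG, sum_skew_one, ← mul_assoc, mul_comm d c, hcd,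
    one_mul]

end Filtration

/-! ### The determinant identity behind a linear factor. -/

section LinearFactor

variable {R : Type*} [CommRing R]

theorem icoeff_linear (y : R) (r : ℤ) :
    icoeff (1 + PowerSeries.C y * PowerSeries.X) r =
      (if r = 0 then 1 else 0) + if r = 1 then y else 0 := by
  rcases lt_or_ge r 0 with h | h
  · rw [icoeff_neg h, if_neg (by omega), if_neg (by omega), add_zero]
  · lift r to ℕ using h
    rw [icoeff_natCast, map_add, PowerSeries.coeff_one, PowerSeries.coeff_C_mul,
      PowerSeries.coeff_X]
    simp

theorem sum_icoeff_linear_left (y : R) (g : ℕ → R) {a K : ℕ} (h : a < K) :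
    ∑ k ∈ range K, icoeff (1 + PowerSeries.C y * PowerSeries.X) ((a : ℤ) - k) * g k =
      g a + if a = 0 then 0 else y * g (a - 1) := by
  simp only [icoeff_linear, add_mul, sum_add_distrib, ite_mul, one_mul, zero_mul]
  congr 1
  · rw [sum_eq_single a]
    · simp
    · intro k _ hk
      exact if_neg (by omega)
    · intro hk
      simp [h] at hk
  · split_ifs with h0
    · exact sum_eq_zero fun k _ => if_neg (by omega)
    · rw [sum_eq_single (a - 1)]
      · exact if_pos (by omega)
      · intro k _ hk
        exact if_neg (by omega)
      · intro hk
        simp only [mem_range] at hk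
        omega

theorem sum_icoeff_linear_right (y : R) (g : ℕ → R) {b K : ℕ} (h : b + 1 < K) :
    ∑ k ∈ range K, icoeff (1 + PowerSeries.C y * PowerSeries.X) ((k : ℤ) - b) * g k =
      g b + y * g (b + 1) := by
  simp only [icoeff_linear, add_mul, sum_add_distrib, ite_mul, one_mul, zero_mul]
  congr 1
  · rw [sum_eq_single b]
    · simp
    · intro k _ hk
      exact if_neg (by omega)
    · intro hk
      simp only [mem_range] at hk
      omega
  · rw [sum_eq_single (b + 1)]
    · exact if_pos (by push_cast; ring)
    · intro k _ hk
      exact if_neg (by omega)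
    · intro hk
      simp [h] at hk

/-- The row `(h_{b_j - k})_j` of a Toeplitz minor. -/
noncomputable def toeplitzRow (H : PowerSeries R) {N : ℕ} (b : Fin N → ℕ) (k : ℤ) : Fin N → R :=
  fun j => icoeff H ((b j : ℤ) - k)

/-- The matrix with rows `r_{a_i} + y r_{a_i - 1}`, where `r_k` is a Toeplitz row. -/
noncomputable def shiftedRows (H : PowerSeries R) (y : R) {N : ℕ} (a b : Fin N → ℕ) :
    Matrix (Fin N) (Fin N) R :=
  Matrix.of fun i => toeplitzRow H b (a i) + y • toeplitzRow H b ((a i : ℤ) - 1)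

theorem shiftedRows_row (H : PowerSeries R) (y : R) {N : ℕ} (a b : Fin N → ℕ) (i : Fin N) :
    shiftedRows H y a b i = toeplitzRow H b (a i) + y • toeplitzRow H b ((a i : ℤ) - 1) := rfl

/-- The determinant of a matrix as a linear function of its last row. -/
noncomputable def detLastRow {K : ℕ} (A : Matrix (Fin (K + 1)) (Fin (K + 1)) R) :
    (Fin (K + 1) → R) →ₗ[R] R :=
  (Matrix.detRowAlternating (R := R)).toMultilinearMap.toLinearMap A (Fin.last K)

theorem detLastRow_apply {K : ℕ} (A : Matrix (Fin (K + 1)) (Fin (K + 1)) R)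
    (v : Fin (K + 1) → R) : detLastRow A v = (A.updateRow (Fin.last K) v).det := rfl

theorem detLastRow_row {K : ℕ} (A : Matrix (Fin (K + 1)) (Fin (K + 1)) R) {i : Fin (K + 1)}
    (hi : i ≠ Fin.last K) : detLastRow A (A i) = 0 :=
  (Matrix.detRowAlternating (R := R)).map_update_self A hi.symm

/-- Column j is the coefficient of H * E = 1 in the positive degree b_j + 1. This ties the row of
index -1 to those of index at least 0. -/
theorem sum_smul_toeplitzRow {H E : PowerSeries R} (hEH : H * E = 1) {N : ℕ} (b : Fin N → ℕ)
    {B : ℕ} (hB : ∀ j, b j + 1 < B) :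
    ∑ r ∈ range B, PowerSeries.coeff r E • toeplitzRow H b ((r : ℤ) - 1) = 0 := by
  ext j
  have h := sum_icoeff_mul H E (b := 0) (hB j)
  rw [hEH, icoeff_one, if_neg (by push_cast; omega)] at h
  rw [Finset.sum_apply, Pi.zero_apply, ← h]
  refine sum_congr rfl fun r _ => ?_
  simp only [Pi.smul_apply, smul_eq_mul, toeplitzRow, Nat.cast_zero, sub_zero, icoeff_natCast]
  rw [mul_comm]
  congr 2
  push_cast
  omega

theorem det_shiftedRows_smodEq {H E : PowerSeries R} (hEH : H * E = 1)
    (hE : PowerSeries.coeff 0 E = 1) (y : R) {K l : ℕ} (hl : l ≤ K) (a b : Fin (K + 1) → ℕ)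
    (ha : ∀ i : Fin (K + 1), l ≤ i → a i = K - i) {I : Ideal R}
    (hI : ∀ r, K - l < r → PowerSeries.coeff r E ∈ I) :
    (shiftedRows H y a b).det ≡ (∑ r ∈ range (K - l + 1), PowerSeries.coeff r E * (-y) ^ r) *
      detLastRow (shiftedRows H y a b) (toeplitzRow H b 0) [SMOD I] := by
  set A := shiftedRows H y a b
  set T := detLastRow A
  -- The zero parts of the partition supply the rows r_{k+1} + y r_k for k < K - l. A repeated row
  -- kills the determinant, so raising the index by one multiplies T by -y.
  have hT : ∀ k : ℕ, k ≤ K - l →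
      T (toeplitzRow H b k) = (-y) ^ k * T (toeplitzRow H b 0) := by
    intro k
    induction k with
    | zero => simp
    | succ k ih =>
      intro hk
      have hi : a ⟨K - (k + 1), by omega⟩ = k + 1 := by
        rw [ha _ (by simp only; omega)]
        simp only
        omega
      have h1 : T (A ⟨K - (k + 1), by omega⟩) = 0 :=
        detLastRow_row A (by rw [Ne, Fin.ext_iff]; simp only [Fin.val_last]; omega)
      have h2 : A ⟨K - (k + 1), by omega⟩ =
          toeplitzRow H b ((k + 1 : ℕ) : ℤ) + y • toeplitzRow H b (k : ℤ) := by
        refine (shiftedRows_row H y a b _).trans ?_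
        rw [hi, Nat.cast_succ, add_sub_cancel_right]
      rw [h2, map_add, map_smul, ih (by omega), smul_eq_mul] at h1
      rw [eq_neg_of_add_eq_zero_left h1]
      ring
  have h0 : A.det = T (toeplitzRow H b 0) + y * T (toeplitzRow H b (-1)) := by
    have h1 : A (Fin.last K) = toeplitzRow H b 0 + y • toeplitzRow H b (-1) := by
      refine (shiftedRows_row H y a b _).trans ?_
      rw [ha _ (by simpa using hl)]
      simp
    have h2 : A.det = T (A (Fin.last K)) := by
      rw [detLastRow_apply, Matrix.updateRow_eq_self]
    rw [h2, h1, map_add, map_smul, smul_eq_mul]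
  -- The range must exceed every b_j + 1 for the recurrence to be complete in each column.
  obtain ⟨B, hB⟩ : ∃ B, ∀ j, b j + 1 < (K - l + B) + 1 :=
    ⟨(∑ j, b j) + 1, fun j => by
      have := single_le_sum (f := b) (fun _ _ => Nat.zero_le _) (mem_univ j)
      omega⟩
  have h3 := congrArg T (sum_smul_toeplitzRow hEH b hB)
  simp only [map_sum, map_smul, map_zero, smul_eq_mul] at h3
  rw [sum_range_succ', hE, sum_range_add] at h3
  have h4 : ∀ r : ℕ, ((r + 1 : ℕ) : ℤ) - 1 = r := fun r => by push_cast; ring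
  simp only [h4, Nat.cast_zero, zero_sub, one_mul] at h3
  rw [sum_congr rfl fun r hr => by rw [hT r (by rw [mem_range] at hr; omega)]] at h3
  -- Beyond K - l the shift rule is not available, but there the coefficients of E lie in I.
  have h5 : ∑ x ∈ range B, PowerSeries.coeff (K - l + x + 1) E *
      T (toeplitzRow H b ((K - l + x : ℕ) : ℤ)) ∈ I :=
    sum_mem fun x _ => Ideal.mul_mem_right _ _ (hI _ (by omega))
  rw [SModEq.sub_mem, h0, sum_range_succ', hE]
  have h6 : ∑ k ∈ range (K - l), PowerSeries.coeff (k + 1) E * (-y) ^ (k + 1) =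
      -y * ∑ k ∈ range (K - l), PowerSeries.coeff (k + 1) E * (-y) ^ k := by
    rw [mul_sum]
    exact sum_congr rfl fun k _ => by ring
  have h7 : ∑ x ∈ range (K - l), PowerSeries.coeff (x + 1) E *
      ((-y) ^ x * T (toeplitzRow H b 0)) =
      (∑ k ∈ range (K - l), PowerSeries.coeff (k + 1) E * (-y) ^ k) * T (toeplitzRow H b 0) := by
    rw [sum_mul]
    exact sum_congr rfl fun k _ => by ring
  rw [h6]
  rw [h7] at h3
  have h8 := Ideal.mul_mem_left I (-y) h5
  convert h8 using 1
  linear_combination y * h3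

end LinearFactor

/-! ### The Cauchy identity for a linear factor. -/

section Commutation

variable {σ R : Type*} [CommRing R]

theorem coeff_zero_linear {S : Type*} [CommRing S] (y : S) :
    PowerSeries.coeff 0 (1 + PowerSeries.C y * PowerSeries.X) = 1 := by
  simp

theorem lowerSum_linear {H : PowerSeries (MvPowerSeries σ R)} (hH0 : PowerSeries.coeff 0 H = 1)
    (y : MvPowerSeries σ R) {α β : YoungDiagram} {K M : ℕ} (hα : α.colLen 0 ≤ K)
    (hβ : β.colLen 0 ≤ K + 1) (hM : α.rowLen 0 ≤ M) :
    lowerSum (1 + PowerSeries.C y * PowerSeries.X) H α β =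
      detLastRow (shiftedRows H y (beta (K + 1) α) (beta (K + 1) β))
        (toeplitzRow H (beta (K + 1) β) 0) := by
  have hαr : α ≤ rect (K + 1) M := le_rect (by omega) hM
  have h1 : lowerSum (1 + PowerSeries.C y * PowerSeries.X) H α β =
      ∑ ν ∈ sub (rect (K + 1) M), minor (1 + PowerSeries.C y * PowerSeries.X) (K + 1) α ν *
        minor H (K + 1) β ν := by
    rw [lowerSum]
    refine (sum_subset (fun ν hν => ?_) fun ν _ hν => ?_).trans (sum_congr rfl fun ν hν => ?_)
    · exact mem_sub.mpr ((mem_sub.mp hν).trans hαr)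
    · rw [skew_eq_zero (by simpa using hν), zero_mul]
    · have h2 := (colLen_le_of_le (mem_sub.mp hν)).trans (colLen_rect_le _ _)
      rw [minor_eq_skew (coeff_zero_linear y) (by omega) h2, minor_eq_skew hH0 hβ h2]
  have h2 := sum_det_mul_det (K + 1) M
    (fun i k => icoeff (1 + PowerSeries.C y * PowerSeries.X) ((beta (K + 1) α i : ℤ) - k))
    (fun j k => icoeff H ((beta (K + 1) β j : ℤ) - k))
  rw [h1]
  refine h2.trans ?_
  rw [detLastRow_apply]
  congr 1
  ext i j
  rw [Matrix.of_apply, sum_icoeff_linear_left y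
    (fun k => icoeff H ((beta (K + 1) β j : ℤ) - k)) (beta_lt hαr i)]
  rcases eq_or_ne i (Fin.last K) with rfl | hi
  · have h3 : beta (K + 1) α (Fin.last K) = 0 := by
      simp [beta, rowLen_eq_zero hα]
    rw [Matrix.updateRow_self, h3]
    simp [toeplitzRow]
  · have h3 : (i : ℕ) < K := by
      have h4 : (i : ℕ) ≠ K := fun h => hi (Fin.ext h)
      omega
    have h5 : beta (K + 1) α i ≠ 0 := by
      simp only [beta]
      omega
    rw [Matrix.updateRow_ne hi, if_neg h5]
    simp only [shiftedRows, Matrix.of_apply, toeplitzRow, Pi.add_apply, Pi.smul_apply,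
      smul_eq_mul]
    congr 4
    omega

theorem sum_rect_linear {H : PowerSeries (MvPowerSeries σ R)} (hH0 : PowerSeries.coeff 0 H = 1)
    (y : MvPowerSeries σ R) {α β : YoungDiagram} {N M : ℕ} (hα : α.colLen 0 ≤ N)
    (hβ : β.colLen 0 ≤ N) (hM : β.rowLen 0 < M) :
    ∑ ν ∈ sub (rect N M), skew (1 + PowerSeries.C y * PowerSeries.X) ν β * skew H ν α =
      (shiftedRows H y (beta N α) (beta N β)).det := by
  have h2 := sum_det_mul_det N M
    (fun i k => icoeff (1 + PowerSeries.C y * PowerSeries.X) ((k : ℤ) - beta N β i))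
    (fun j k => icoeff H ((k : ℤ) - beta N α j))
  rw [← Matrix.det_transpose]
  refine Eq.trans (sum_congr rfl fun ν hν => ?_) (h2.trans ?_)
  · have h3 := (colLen_le_of_le (mem_sub.mp hν)).trans (colLen_rect_le _ _)
    rw [← minor_eq_skew (coeff_zero_linear y) h3 hβ, ← minor_eq_skew hH0 h3 hα, minor, minor,
      ← Matrix.det_transpose, ← Matrix.det_transpose (Matrix.of fun i j => icoeff H _)]
    rfl
  · refine congrArg Matrix.det (Matrix.ext fun i j => ?_)
    -- The strict bound on the first part of β keeps the shifted column b + 1 inside the range.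
    have h4 : beta N β i + 1 < N + M := by
      have := beta_lt (le_rect hβ (le_refl (β.rowLen 0))) i
      omega
    rw [Matrix.of_apply, sum_icoeff_linear_right y
      (fun k => icoeff H ((k : ℤ) - beta N α j)) h4]
    have h5 : ((beta N β i + 1 : ℕ) : ℤ) - beta N α j = beta N β i - ((beta N α j : ℤ) - 1) := by
      omega
    rw [h5]
    rfl

/-- `c` is the value `E(y)` of the power series `E` at `y`. -/
def HasValue (E : PowerSeries (MvPowerSeries σ R)) (y c : MvPowerSeries σ R) : Prop :=
  ∀ d, ∃ N, ∀ n ≥ N, c ≡ ∑ r ∈ range n, PowerSeries.coeff r E * y ^ r [SMOD orderIdeal σ R d]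

theorem commutes_linear {H E : PowerSeries (MvPowerSeries σ R)} (hEH : H * E = 1)
    (hH : Graded H) (hE : Graded E) (hH0 : PowerSeries.coeff 0 H = 1)
    (hE0 : PowerSeries.coeff 0 E = 1) {y c : MvPowerSeries σ R} (hc : HasValue E (-y) c) :
    Commutes (1 + PowerSeries.C y * PowerSeries.X) H c := by
  intro α β
  refine eq_of_smodEq fun d => ?_
  obtain ⟨n₀, hn₀⟩ := hc d
  -- K makes the partial sum of E(-y) long enough, pushes the discarded coefficients of E to order
  -- at least d, and makes the rectangle large enough for both partitions and the upper sum.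
  obtain ⟨K, hK⟩ : ∃ K, K = n₀ + d + weight α + α.colLen 0 + β.colLen 0 + β.rowLen 0 := ⟨_, rfl⟩
  refine (upperSum_smodEq _ hH β (n := K + 1) (by omega)).trans ?_
  rw [sum_rect_linear hH0 y (by omega) (by omega) (by omega)]
  refine (det_shiftedRows_smodEq hEH hE0 y (l := α.colLen 0) (by omega) _ _ ?_ ?_).trans ?_
  · intro i hi
    simp [beta, rowLen_eq_zero hi]
  · intro r hr
    exact orderIdeal_anti (by omega) (hE r)
  · rw [lowerSum_linear hH0 y (K := K) (by omega) (by omega) le_rfl]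
    exact (hn₀ _ (by omega)).symm.mul SModEq.rfl

end Commutation

/-! ### The supersymmetric generating series and its coefficients. -/

section Series

variable {S : Type*} [CommRing S]

/-- The linear power series `1 + y t`. -/
noncomputable def linSeries (y : S) : PowerSeries S := 1 + PowerSeries.C y * PowerSeries.X

/-- The geometric series `1 / (1 - x t)`. -/
noncomputable def geomSeries (x : S) : PowerSeries S := PowerSeries.mk fun r => x ^ r

theorem linSeries_mul_geomSeries (x : S) : linSeries (-x) * geomSeries x = 1 := by
  ext r
  rw [linSeries, add_mul, one_mul, mul_assoc, map_add, PowerSeries.coeff_C_mul,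
    PowerSeries.coeff_one]
  cases r with
  | zero => simp [geomSeries]
  | succ r =>
    rw [PowerSeries.coeff_succ_X_mul]
    simp [geomSeries, pow_succ']

theorem linSeries_mul_geomSeries_neg (y : S) : linSeries y * geomSeries (-y) = 1 := by
  simpa using linSeries_mul_geomSeries (-y)

theorem coeff_zero_linSeries (y : S) : PowerSeries.coeff 0 (linSeries y) = 1 :=
  coeff_zero_linear y

theorem coeff_zero_geomSeries (x : S) : PowerSeries.coeff 0 (geomSeries x) = 1 := by
  simp [geomSeries]

theorem coeff_zero_mul {F G : PowerSeries S} (hF : PowerSeries.coeff 0 F = 1)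
    (hG : PowerSeries.coeff 0 G = 1) : PowerSeries.coeff 0 (F * G) = 1 := by
  rw [PowerSeries.coeff_zero_eq_constantCoeff_apply] at *
  rw [map_mul, hF, hG, one_mul]

theorem coeff_zero_prod {ι : Type*} (s : Finset ι) {F : ι → PowerSeries S}
    (h : ∀ i, PowerSeries.coeff 0 (F i) = 1) : PowerSeries.coeff 0 (∏ i ∈ s, F i) = 1 :=
  prod_induction _ (fun F => PowerSeries.coeff 0 F = 1) (fun _ _ => coeff_zero_mul) (by simp)
    fun i _ => h i

/-- The series `∏ (1 + y_i t) / (1 - x_i t)`. -/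
noncomputable def superSeries {n : ℕ} (x y : Fin n → S) : PowerSeries S :=
  ∏ i, (linSeries (y i) * geomSeries (x i))

theorem coeff_zero_superSeries {n : ℕ} (x y : Fin n → S) :
    PowerSeries.coeff 0 (superSeries x y) = 1 :=
  coeff_zero_prod _ fun _ => coeff_zero_mul (coeff_zero_linSeries _) (coeff_zero_geomSeries _)

theorem superSeries_mul_superSeries_neg {n : ℕ} (x y : Fin n → S) :
    superSeries x y * superSeries (fun i => -y i) (fun i => -x i) = 1 := by
  rw [superSeries, superSeries, ← prod_mul_distrib]
  refine prod_eq_one fun i _ => ?_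
  calc _ = (linSeries (y i) * geomSeries (-y i)) * (linSeries (-x i) * geomSeries (x i)) := by ring
    _ = 1 := by rw [linSeries_mul_geomSeries_neg, linSeries_mul_geomSeries, one_mul]

theorem coeff_prod_linSeries {n : ℕ} (y : Fin n → S) (r : ℕ) :
    PowerSeries.coeff r (∏ i, linSeries (y i)) =
      MvPolynomial.aeval y (MvPolynomial.esymm (Fin n) ℤ r) := by
  have h : ∀ t : Finset (Fin n),
      PowerSeries.coeff r (∏ i ∈ t, PowerSeries.C (y i) * PowerSeries.X) =
        if t.card = r then ∏ i ∈ t, y i else 0 := by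
    intro t
    rw [prod_mul_distrib, prod_const, ← map_prod, PowerSeries.coeff_C_mul,
      PowerSeries.coeff_X_pow, mul_ite, mul_one, mul_zero]
    simp only [eq_comm]
  simp only [linSeries, prod_one_add, map_sum, h, MvPolynomial.esymm, map_prod,
    MvPolynomial.aeval_X]
  rw [← sum_filter, powersetCard_eq_filter]

theorem coeff_prod_geomSeries {n : ℕ} (x : Fin n → S) (r : ℕ) :
    PowerSeries.coeff r (∏ i, geomSeries (x i)) =
      MvPolynomial.aeval x (MvPolynomial.hsymm (Fin n) ℤ r) := by
  classical
  rw [PowerSeries.coeff_prod, MvPolynomial.hsymm, map_sum]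
  symm
  -- Multisets of size r correspond to exponent vectors of total degree r.
  refine sum_bij (fun s _ => Multiset.toFinsupp s.1) ?_ ?_ ?_ ?_
  · intro s _
    rw [mem_finsuppAntidiag]
    refine ⟨?_, subset_univ _⟩
    have h := Multiset.sum_count_eq_card (s := univ) (m := s.1) (fun _ _ => mem_univ _)
    exact h.trans s.2
  · intro s _ t _ h
    exact Subtype.ext (Multiset.toFinsupp.injective h)
  · intro l hl
    rw [mem_finsuppAntidiag] at hl
    refine ⟨⟨Multiset.toFinsupp.symm l, ?_⟩, mem_univ _, by simp⟩
    have h := Multiset.sum_count_eq_card (s := univ) (m := Multiset.toFinsupp.symm l)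
      (fun _ _ => mem_univ _)
    rw [← h, ← hl.1]
    refine sum_congr rfl fun i _ => ?_
    rw [← Multiset.toFinsupp_apply]
    simp
  · intro s _
    rw [← Multiset.prod_hom, Multiset.map_map]
    simp only [Function.comp_def, MvPolynomial.aeval_X, geomSeries, PowerSeries.coeff_mk,
      Multiset.toFinsupp_apply]
    rw [prod_multiset_map_count]
    refine prod_subset (subset_univ _) fun i _ hi => ?_
    rw [Multiset.count_eq_zero_of_notMem (by simpa using hi), pow_zero]

theorem superH_eq_icoeff {n : ℕ} (x y : Fin n → S) (r : ℤ) :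
    superH x y r = icoeff (superSeries x y) r := by
  rw [superH, icoeff, superSeries, prod_mul_distrib, mul_comm, PowerSeries.coeff_mul]
  simp only [coeff_prod_geomSeries, coeff_prod_linSeries]

theorem superSchur_eq_skew {n : ℕ} (α β : YoungDiagram) (x y : Fin n → S) :
    superSchur α β x y = skew (superSeries x y) α β := by
  simp only [superSchur, skew, minor, superH_eq_icoeff, beta_sub_beta]

end Series

/-! ### Values of graded series; commutation for finite products. -/

section Values

variable {σ R : Type*} [CommRing R]

theorem pow_mem_orderIdeal {x : MvPowerSeries σ R} (hx : x ∈ orderIdeal σ R 1) (r : ℕ) :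
    x ^ r ∈ orderIdeal σ R r := by
  have := prod_mem_orderIdeal (range r) (f := fun _ => x) (d := fun _ => 1) fun _ _ => hx
  simpa using this

theorem graded_geomSeries {x : MvPowerSeries σ R} (hx : x ∈ orderIdeal σ R 1) :
    Graded (geomSeries x) := by
  intro r
  rw [geomSeries, PowerSeries.coeff_mk]
  exact pow_mem_orderIdeal hx r

theorem graded_linSeries {y : MvPowerSeries σ R} (hy : y ∈ orderIdeal σ R 1) :
    Graded (linSeries y) := by
  intro r
  rw [linSeries, map_add, PowerSeries.coeff_C_mul, PowerSeries.coeff_X]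
  refine add_mem (Graded.one r) ?_
  split_ifs with h
  · rw [h, mul_one]
    exact hy
  · rw [mul_zero]
    exact zero_mem _

theorem graded_superSeries {n : ℕ} {x y : Fin n → MvPowerSeries σ R}
    (hx : ∀ i, x i ∈ orderIdeal σ R 1) (hy : ∀ i, y i ∈ orderIdeal σ R 1) :
    Graded (superSeries x y) :=
  Graded.prod _ fun i => (graded_linSeries (hy i)).mul (graded_geomSeries (hx i))

theorem HasValue.one (t : MvPowerSeries σ R) : HasValue 1 t 1 := by
  refine fun d => ⟨1, fun n hn => ?_⟩
  rw [sum_eq_single_of_mem 0 (mem_range.mpr hn)]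
  · simp
  · intro r _ hr
    rw [PowerSeries.coeff_one, if_neg hr, zero_mul]

theorem HasValue.mul {E F : PowerSeries (MvPowerSeries σ R)} {t b c : MvPowerSeries σ R}
    (hE : HasValue E t b) (hF : HasValue F t c) (hEg : Graded E) (hFg : Graded F) :
    HasValue (E * F) t (b * c) := by
  intro d
  obtain ⟨N, hN⟩ := hE d
  obtain ⟨M, hM⟩ := hF d
  refine ⟨max d (max N M), fun n hn => ?_⟩
  simp only [ge_iff_le, max_le_iff] at hn
  refine ((hN n hn.2.1).mul (hM n hn.2.2)).trans ?_
  rw [sum_mul_sum, ← sum_product', SModEq.sub_mem]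
  have h1 : ∑ r ∈ range n, PowerSeries.coeff r (E * F) * t ^ r =
      ∑ p ∈ range n ×ˢ range n with p.1 + p.2 < n,
        PowerSeries.coeff p.1 E * t ^ p.1 * (PowerSeries.coeff p.2 F * t ^ p.2) := by
    rw [← sum_fiberwise_of_maps_to (t := range n) (g := fun p : ℕ × ℕ => p.1 + p.2)]
    · refine sum_congr rfl fun r hr => ?_
      rw [PowerSeries.coeff_mul, sum_mul]
      refine sum_congr ?_ fun p hp => ?_
      · ext p
        simp only [HasAntidiagonal.mem_antidiagonal, mem_filter, mem_product, mem_range] at *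
        omega
      · simp only [mem_filter] at hp
        rw [← hp.2, pow_add]
        ring
    · intro p hp
      simp only [mem_filter] at hp
      exact mem_range.mpr hp.2
  rw [h1, ← sum_filter_add_sum_filter_not (range n ×ˢ range n) (fun p => p.1 + p.2 < n),
    add_sub_cancel_left]
  -- What remains of the square has p.1 + p.2 ≥ n ≥ d, hence order at least d by gradedness.
  refine sum_mem fun p hp => ?_
  rw [mul_mul_mul_comm]
  refine Ideal.mul_mem_right _ _ (orderIdeal_anti ?_ (mul_mem_orderIdeal (hEg _) (hFg _)))
  simp only [mem_filter] at hp
  omega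

theorem hasValue_linSeries (y t : MvPowerSeries σ R) : HasValue (linSeries y) t (1 + y * t) := by
  refine fun d => ⟨2, fun n hn => ?_⟩
  obtain ⟨k, rfl⟩ := Nat.exists_eq_add_of_le hn
  rw [sum_range_add, sum_eq_zero (s := range k), add_zero]
  · simp [sum_range_succ, linSeries, PowerSeries.coeff_one]
  · intro r _
    rw [linSeries, map_add, PowerSeries.coeff_one, PowerSeries.coeff_C_mul,
      PowerSeries.coeff_X, if_neg (by omega), if_neg (by omega)]
    simp

theorem hasValue_geomSeries {x t c : MvPowerSeries σ R} (hx : x ∈ orderIdeal σ R 1)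
    (hc : (1 - x * t) * c = 1) : HasValue (geomSeries x) t c := by
  refine fun d => ⟨d, fun n hn => ?_⟩
  simp only [geomSeries, PowerSeries.coeff_mk, ← mul_pow]
  have h1 : c - ∑ r ∈ range n, (x * t) ^ r = (x * t) ^ n * c := by
    have h := geom_sum_mul (x * t) n
    linear_combination (∑ r ∈ range n, (x * t) ^ r) * hc + c * h
  rw [SModEq.sub_mem, h1]
  exact Ideal.mul_mem_right _ _
    (orderIdeal_anti hn (pow_mem_orderIdeal (Ideal.mul_mem_right _ _ hx) n))

theorem HasValue.prod {ι : Type*} (s : Finset ι) {F : ι → PowerSeries (MvPowerSeries σ R)}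
    {t : MvPowerSeries σ R} {c : ι → MvPowerSeries σ R} (h : ∀ i, HasValue (F i) t (c i))
    (hF : ∀ i, Graded (F i)) : HasValue (∏ i ∈ s, F i) t (∏ i ∈ s, c i) := by
  classical
  induction s using Finset.induction_on with
  | empty => simpa using HasValue.one t
  | insert a s ha ih =>
    rw [prod_insert ha, prod_insert ha]
    exact (h a).mul ih (hF a) (Graded.prod _ hF)

theorem Commutes.one (H : PowerSeries (MvPowerSeries σ R)) : Commutes 1 H 1 := by
  intro α β
  rw [upperSum_one, lowerSum, sum_skew_one, one_mul]

theorem Commutes.prod {ι : Type*} (s : Finset ι) {F : ι → PowerSeries (MvPowerSeries σ R)}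
    {H : PowerSeries (MvPowerSeries σ R)} {c : ι → MvPowerSeries σ R}
    (h : ∀ i, Commutes (F i) H (c i)) (hH : Graded H)
    (hF : ∀ i, PowerSeries.coeff 0 (F i) = 1) : Commutes (∏ i ∈ s, F i) H (∏ i ∈ s, c i) := by
  classical
  induction s using Finset.induction_on with
  | empty => simpa using Commutes.one H
  | insert a s ha ih =>
    rw [prod_insert ha, prod_insert ha]
    exact (h a).mul ih hH (hF a) (coeff_zero_prod _ hF)

end Values

/-! ### The Cauchy kernel in the supersymmetric case. -/

section SuperCauchy

variable {σ k : Type*} [Field k] {m : ℕ} {z w : Fin m → MvPowerSeries σ k}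

theorem one_add_mul_inv_cancel {f : MvPowerSeries σ k} (hf : f ∈ orderIdeal σ k 1) :
    (1 + f) * (1 + f)⁻¹ = 1 := by
  refine MvPowerSeries.mul_inv_cancel _ ?_
  have h : MvPowerSeries.constantCoeff f = 0 :=
    MvPowerSeries.one_le_order_iff_constCoeff_eq_zero.mp (by simpa using mem_orderIdeal.mp hf)
  rw [map_add, map_one, h, add_zero]
  exact one_ne_zero

theorem one_sub_mul_inv_cancel {f : MvPowerSeries σ k} (hf : f ∈ orderIdeal σ k 1) :
    (1 - f) * (1 - f)⁻¹ = 1 := by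
  rw [sub_eq_add_neg]
  exact one_add_mul_inv_cancel (neg_mem hf)

/-- The inverse of ∏ (1 + w_j t) / (1 - z_j t) is the series of the same kind with z and w exchanged
and negated; the kernel is its value at -y. -/
theorem commutes_linSeries (hz : ∀ j, z j ∈ orderIdeal σ k 1) (hw : ∀ j, w j ∈ orderIdeal σ k 1)
    (y : MvPowerSeries σ k) :
    Commutes (linSeries y) (superSeries z w) (∏ j, (1 + y * z j) * (1 - y * w j)⁻¹) := by
  refine commutes_linear (superSeries_mul_superSeries_neg z w) (graded_superSeries hz hw)
    (graded_superSeries (fun j => neg_mem (hw j)) fun j => neg_mem (hz j))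
    (coeff_zero_superSeries _ _) (coeff_zero_superSeries _ _) ?_
  refine HasValue.prod _ (fun j => HasValue.mul ?_ ?_ ?_ ?_)
    fun j => (graded_linSeries (neg_mem (hz j))).mul (graded_geomSeries (neg_mem (hw j)))
  · have := hasValue_linSeries (-z j) (-y)
    rwa [neg_mul_neg, mul_comm (z j)] at this
  · refine hasValue_geomSeries (neg_mem (hw j)) ?_
    rw [neg_mul_neg, mul_comm (w j)]
    exact one_sub_mul_inv_cancel (Ideal.mul_mem_left _ _ (hw j))
  · exact graded_linSeries (neg_mem (hz j))
  · exact graded_geomSeries (neg_mem (hw j))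

/-- The geometric series is inverse to 1 - xt, so its kernel is the inverse of the linear kernel at
-x. -/
theorem commutes_geomSeries (hz : ∀ j, z j ∈ orderIdeal σ k 1)
    (hw : ∀ j, w j ∈ orderIdeal σ k 1) (x : MvPowerSeries σ k) :
    Commutes (geomSeries x) (superSeries z w) (∏ j, (1 + x * w j) * (1 - x * z j)⁻¹) := by
  refine (commutes_linSeries hz hw (-x)).of_mul_eq_one (graded_superSeries hz hw)
    (coeff_zero_linSeries _) (coeff_zero_geomSeries _) (linSeries_mul_geomSeries x) ?_
  rw [← prod_mul_distrib]
  refine prod_eq_one fun j _ => ?_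
  have h1 := one_sub_mul_inv_cancel (Ideal.mul_mem_left _ x (hz j))
  have h2 := one_add_mul_inv_cancel (Ideal.mul_mem_left _ x (hw j))
  rw [neg_mul, neg_mul, ← sub_eq_add_neg, sub_neg_eq_add]
  calc _ = ((1 - x * z j) * (1 - x * z j)⁻¹) * ((1 + x * w j) * (1 + x * w j)⁻¹) := by ring
    _ = 1 := by rw [h1, h2, one_mul]

theorem commutes_superSeries (hz : ∀ j, z j ∈ orderIdeal σ k 1)
    (hw : ∀ j, w j ∈ orderIdeal σ k 1) {n : ℕ} (x y : Fin n → MvPowerSeries σ k) :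
    Commutes (superSeries x y) (superSeries z w)
      (∏ i, ((∏ j, (1 + y i * z j) * (1 - y i * w j)⁻¹) *
        ∏ j, (1 + x i * w j) * (1 - x i * z j)⁻¹)) :=
  Commutes.prod _ (fun i => (commutes_linSeries hz hw (y i)).mul (commutes_geomSeries hz hw (x i))
    (graded_superSeries hz hw) (coeff_zero_linSeries _) (coeff_zero_geomSeries _))
    (graded_superSeries hz hw)
    fun _ => coeff_zero_mul (coeff_zero_linSeries _) (coeff_zero_geomSeries _)

theorem lowerSum_eq_kernel_mul_upperSum (hz : ∀ j, z j ∈ orderIdeal σ k 1)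
    (hw : ∀ j, w j ∈ orderIdeal σ k 1) {n : ℕ} (x y : Fin n → MvPowerSeries σ k)
    (α β : YoungDiagram) :
    lowerSum (superSeries x y) (superSeries z w) α β =
      (∏ i, ∏ j, ((1 - x i * z j) * (1 - y i * w j)) *
        ((1 + x i * w j) * (1 + y i * z j))⁻¹) *
      upperSum (superSeries x y) (superSeries z w) α β := by
  rw [commutes_superSeries hz hw x y α β, ← mul_assoc, ← prod_mul_distrib, prod_eq_one, one_mul]
  intro i _
  rw [← prod_mul_distrib, ← prod_mul_distrib]
  refine prod_eq_one fun j _ => ?_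
  have h1 := one_sub_mul_inv_cancel (Ideal.mul_mem_left _ (x i) (hz j))
  have h2 := one_add_mul_inv_cancel (Ideal.mul_mem_left _ (x i) (hw j))
  have h3 := one_add_mul_inv_cancel (Ideal.mul_mem_left _ (y i) (hz j))
  have h4 := one_sub_mul_inv_cancel (Ideal.mul_mem_left _ (y i) (hw j))
  rw [MvPowerSeries.mul_inv_rev]
  calc _ = ((1 - x i * z j) * (1 - x i * z j)⁻¹) * ((1 + x i * w j) * (1 + x i * w j)⁻¹) *
        (((1 + y i * z j) * (1 + y i * z j)⁻¹) * ((1 - y i * w j) * (1 - y i * w j)⁻¹)) := by ring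
    _ = 1 := by rw [h1, h2, h3, h4, one_mul, one_mul]

end SuperCauchy

/-! ### Formal summability of both sides. -/

section Summability

variable {σ R : Type*} [CommRing R]

theorem formallySummable_of_lower (F H : PowerSeries (MvPowerSeries σ R)) (α β : YoungDiagram) :
    FormallySummable fun ν => skew F α ν * skew H β ν := by
  intro m
  refine (sub α).finite_toSet.subset fun ν hν => ?_
  by_contra h
  refine hν ?_
  change MvPowerSeries.coeff m (skew F α ν * skew H β ν) = 0
  rw [skew_eq_zero (by simpa using h), zero_mul, map_zero]

theorem formalSum_lower (F H : PowerSeries (MvPowerSeries σ R)) (α β : YoungDiagram) :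
    formalSum (fun ν => skew F α ν * skew H β ν) = lowerSum F H α β := by
  refine eq_of_smodEq fun d => formalSum_smodEq fun ν hν => ?_
  rw [skew_eq_zero (by simpa using hν), zero_mul]
  exact zero_mem _

theorem formallySummable_of_upper (F : PowerSeries (MvPowerSeries σ R))
    {H : PowerSeries (MvPowerSeries σ R)} (hH : Graded H) (α β : YoungDiagram) :
    FormallySummable fun ν => skew F ν β * skew H ν α := by
  intro m
  let n := m.degree + 1 + weight α
  refine (sub (rect n n)).finite_toSet.subset fun ν hν => ?_
  by_contra h
  exact hν (mem_orderIdeal_iff_coeff.mp (Ideal.mul_mem_left _ _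
    (skew_mem_orderIdeal hH (le_refl n) (by simpa using h))) m (Nat.lt_succ_self _))

theorem X_mem_orderIdeal (s : σ) : (MvPowerSeries.X s : MvPowerSeries σ R) ∈ orderIdeal σ R 1 := by
  rw [mem_orderIdeal, Nat.cast_one, MvPowerSeries.one_le_order_iff_constCoeff_eq_zero,
    MvPowerSeries.constantCoeff_X]

end Summability

end SkewCauchy

theorem mainTheorem10 (n m : ℕ) (α β : YoungDiagram) :
    FormallySummable (fun ν : YoungDiagram =>
      superSchur α ν (xVar n m) (yVar n m) * superSchur β ν (zVar n m) (wVar n m)) ∧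
    FormallySummable (fun ν : YoungDiagram =>
      superSchur ν β (xVar n m) (yVar n m) * superSchur ν α (zVar n m) (wVar n m)) ∧
    formalSum (fun ν : YoungDiagram =>
      superSchur α ν (xVar n m) (yVar n m) * superSchur β ν (zVar n m) (wVar n m)) =
    (∏ i : Fin n, ∏ j : Fin m,
      ((1 - xVar n m i * zVar n m j) * (1 - yVar n m i * wVar n m j)) *
        ((1 + xVar n m i * wVar n m j) * (1 + yVar n m i * zVar n m j))⁻¹) *
    formalSum (fun ν : YoungDiagram =>
      superSchur ν β (xVar n m) (yVar n m) * superSchur ν α (zVar n m) (wVar n m)) := by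
  have hz : ∀ j, zVar n m j ∈ SkewCauchy.orderIdeal (CauchyVar n m) ℂ 1 := fun _ =>
    SkewCauchy.X_mem_orderIdeal _
  have hw : ∀ j, wVar n m j ∈ SkewCauchy.orderIdeal (CauchyVar n m) ℂ 1 := fun _ =>
    SkewCauchy.X_mem_orderIdeal _
  simp only [SkewCauchy.superSchur_eq_skew]
  refine ⟨SkewCauchy.formallySummable_of_lower _ _ _ _,
    SkewCauchy.formallySummable_of_upper _ (SkewCauchy.graded_superSeries hz hw) _ _, ?_⟩
  rw [SkewCauchy.formalSum_lower]
  exact SkewCauchy.lowerSum_eq_kernel_mul_upperSum hz hw _ _ α β
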